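/- Let $N\in\mathbb N_0$ and let $\omega:[0,\infty)\to[0,\infty)$ be a non-quasianalytic weight function, i.e. $\omega$ is continuous and increasing (in the wide sense) and * ($\alpha$) there is $K\ge 1$ with $\omega(2t)\le K(1+\omega(t))$ for all $t\ge 0$; * ($\beta$) $\int_1^\infty \frac{\omega(t)}{1+t^2}\,dt<\infty$; * ($\gamma$) there are $a\in\mathbb R$, $b>0$ with $\omega(t)\ge a+b\log(1+t)$ for all $t\ge 0$; * ($\delta$) $\varphi_\omega(t)=\omega(e^t)$ is convex on $\mathbb R$. Put $\omega(x)=\omega(|x|)$ for $x\in\mathbb R^N$ (Euclidean norm) and $\varphi^*_\omega(s)=\sup_{t\ge 0}\{st-\varphi_\omega(t)\}\in(-\infty,+\infty]$ for $s\ge0$, with $\exp(+\infty)=+\infty$ and $\exp(-\infty)=0$. All functions are complex valued. * $\mathcal S_\omega(\mathbb R^N)$ is the set of all $g\in L^1(\mathbb R^N)$ such that $g,\hat g\in C^\infty(\mathbb R^N)$, where $\hat g(\xi)=\int g(x)e^{-ix\cdot\xi}\,dx$, and $\|\exp(\lambda\omega)\partial^\alpha g\|_\infty<\infty$ and $\|\exp(\lambda\omega)\partial^\alpha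 \hat g\|_\infty<\infty$ for all $\lambda>0$ and $\alpha\in\mathbb N_0^N$. * $\mathcal O_{M,\omega}(\mathbb R^N)$ is the set of all $f\in C^\infty(\mathbb R^N)$ such that for every $m\in\mathbb N=\{1,2,\dots\}$ there are $C>0$ and $n\in\mathbb N$ with $|\partial^\alpha f(x)|\le C\exp\big(n\omega(x)+m\varphi^*_\omega(|\alpha|/m)\big)$ for all $\alpha\in\mathbb N_0^N$ and $x\in\mathbb R^N$. It is a linear space. * For $m\in\mathbb N$, $g\in\mathcal S_\omega(\mathbb R^N)$ and $f\in C^\infty(\mathbb R^N)$ let $$q_{m,g}(f)=\sup_{\alpha\in\mathbb N_0^N}\sup_{x\in\mathbb R^N}|g(x)|\,|\partial^\alpha f(x)|\exp\big(-m\varphi^*_\omega(|\alpha|/m)\big)\in[0,\infty].$$ Then the following hold. 1. A function $f\in C^\infty(\mathbb R^N)$ belongs to $\mathcal O_{M,\omega}(\mathbb R^N)$ if and only if $q_{m,g}(f)<\infty$ for every $g\in\mathcal S_\omega(\mathbb R^N)$ and every $m\in\mathbb N$. 2. Let $\tau$ be the topology on $\mathcal O_{M,\omega}(\mathbb R^N)$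 generated by the family $\{q_{m,g}\}_{m\in\mathbb N,\,g\in\mathcal S_\omega(\mathbb R^N)}$, that is, the coarsest topology in which all balls $\{f : q_{m,g}(f-f_0)<\varepsilon\}$ with $f_0\in\mathcal O_{M,\omega}(\mathbb R^N)$ and $\varepsilon>0$ are open. The $q_{m,g}$ are (finite) seminorms on $\mathcal O_{M,\omega}(\mathbb R^N)$, and $\tau$ is the locally convex topology defined by this family of seminorms; it is Hausdorff. Moreover $q_{m,g}$ is a norm whenever $g$ has no zeros, and the sets $\{f: q_{m,g}(f)<\varepsilon\}$ with $m\in\mathbb N$, $\varepsilon>0$ and $g\in\mathcal S_\omega(\mathbb R^N)$ without zeros form a fundamental system of neighbourhoods of $0$ for $\tau$. -/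

import Mathlib

open scoped ENNReal

/-- A non-quasianalytic weight function `ω : [0,∞) → [0,∞)` (in the sense of Braun, Meise and
Taylor, Beurling case).  It is represented by a function on `ℝ` of which only the values on
`[0,∞)` are ever used; "increasing" is meant in the wide sense. -/
structure IsNonQuasianalyticWeight (ω : ℝ → ℝ) : Prop where
  continuousOn : ContinuousOn ω (Set.Ici 0)
  monotoneOn : MonotoneOn ω (Set.Ici 0)
  nonneg : ∀ t, 0 ≤ t → 0 ≤ ω t
  alpha : ∃ K : ℝ, 1 ≤ K ∧ ∀ t, 0 ≤ t → ω (2 * t) ≤ K * (1 + ω t)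
  beta : MeasureTheory.IntegrableOn (fun t => ω t / (1 + t ^ 2)) (Set.Ioi 1)
  gamma : ∃ a b : ℝ, 0 < b ∧ ∀ t, 0 ≤ t → a + b * Real.log (1 + t) ≤ ω t
  delta : ConvexOn ℝ Set.univ (fun t => ω (Real.exp t))

/-- The Young conjugate `φ*_ω(s) = sup_{t ≥ 0} (s t - ω(e^t))`.  It takes values in the extended
reals: it is `+∞` for large `s` when `ω` grows like a logarithm. -/
noncomputable def youngConj (ω : ℝ → ℝ) (s : ℝ) : EReal :=
  ⨆ t : Set.Ici (0 : ℝ), ((s * (t : ℝ) - ω (Real.exp (t : ℝ)) : ℝ) : EReal)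

/-- The length `|α|` of a multi-index. -/
def multiLength {N : ℕ} (α : Fin N → ℕ) : ℕ := ∑ i, α i

/-- The `i`-th partial derivative. -/
noncomputable def pderiv {N : ℕ} (i : Fin N) (f : EuclideanSpace ℝ (Fin N) → ℂ) :
    EuclideanSpace ℝ (Fin N) → ℂ :=
  fun x => lineDeriv ℝ f x (EuclideanSpace.single i (1 : ℝ))

/-- The derivative `∂^α f = ∂_1^{α_1} ⋯ ∂_N^{α_N} f` for a multi-index `α`. -/
noncomputable def mderiv {N : ℕ} (α : Fin N → ℕ) (f : EuclideanSpace ℝ (Fin N) → ℂ) :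
    EuclideanSpace ℝ (Fin N) → ℂ :=
  (List.finRange N).foldr (fun i h => (pderiv i)^[α i] h) f

/-- The Fourier transform with the convention `f̂(ξ) = ∫ f(x) e^{-i x·ξ} dx`. -/
noncomputable def fourierHat {N : ℕ} (f : EuclideanSpace ℝ (Fin N) → ℂ) :
    EuclideanSpace ℝ (Fin N) → ℂ :=
  fun ξ => ∫ x, f x * Complex.exp (-(Complex.I * ((inner ℝ x ξ : ℝ) : ℂ)))

/-- The space `S_ω(ℝ^N)` of `ω`-ultradifferentiable rapidly decreasing functions of Beurling
type. -/
def SSpace (N : ℕ) (ω : ℝ → ℝ) : Set (EuclideanSpace ℝ (Fin N) → ℂ) :=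
  {g | MeasureTheory.Integrable g ∧ ContDiff ℝ (⊤ : ℕ∞) g ∧ ContDiff ℝ (⊤ : ℕ∞) (fourierHat g) ∧
    ∀ l : ℝ, 0 < l → ∀ α : Fin N → ℕ,
      (∃ C : ℝ, ∀ x, Real.exp (l * ω ‖x‖) * ‖mderiv α g x‖ ≤ C) ∧
      (∃ C : ℝ, ∀ ξ, Real.exp (l * ω ‖ξ‖) * ‖mderiv α (fourierHat g) ξ‖ ≤ C)}

/-- The quantity `m φ*_ω(|α|/m)`. -/
noncomputable def youngWeight {N : ℕ} (ω : ℝ → ℝ) (m : ℕ) (α : Fin N → ℕ) : EReal :=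
  ((m : ℝ) : EReal) * youngConj ω ((multiLength α : ℝ) / (m : ℝ))

/-- The set `O_{M,ω}(ℝ^N)` of slowly increasing functions of Beurling type. -/
def OMSet (N : ℕ) (ω : ℝ → ℝ) : Set (EuclideanSpace ℝ (Fin N) → ℂ) :=
  {f | ContDiff ℝ (⊤ : ℕ∞) f ∧ ∀ m : ℕ, 1 ≤ m → ∃ C : ℝ, 0 < C ∧ ∃ n : ℕ, 1 ≤ n ∧
    ∀ (α : Fin N → ℕ) (x : EuclideanSpace ℝ (Fin N)),
      ‖mderiv α f x‖ₑ ≤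
        ENNReal.ofReal C * EReal.exp ((((n : ℝ) * ω ‖x‖ : ℝ) : EReal) + youngWeight ω m α)}

/-- `q_{m,g}(f) = sup_α sup_x |g(x)| |∂^α f(x)| exp(-m φ*_ω(|α|/m))`, with values in `[0,∞]` and
with `exp(-∞) = 0`. -/
noncomputable def qNorm {N : ℕ} (ω : ℝ → ℝ) (m : ℕ) (g f : EuclideanSpace ℝ (Fin N) → ℂ) :
    ℝ≥0∞ :=
  ⨆ (α : Fin N → ℕ) (x : EuclideanSpace ℝ (Fin N)),
    ‖g x‖ₑ * ‖mderiv α f x‖ₑ * EReal.exp (-youngWeight ω m α)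

/-! ### `O_{M,ω}(ℝ^N)` is a linear space -/

theorem contDiff_pderiv {N : ℕ} (i : Fin N) {f : EuclideanSpace ℝ (Fin N) → ℂ}
    (hf : ContDiff ℝ (⊤ : ℕ∞) f) : ContDiff ℝ (⊤ : ℕ∞) (pderiv i f) := by
  have h : pderiv i f = fun x => fderiv ℝ f x (EuclideanSpace.single i (1 : ℝ)) := by
    funext x
    exact (hf.differentiable (by simp)).differentiableAt.lineDeriv_eq_fderiv
  rw [h]
  exact (hf.fderiv_right (m := ((⊤ : ℕ∞) : WithTop ℕ∞)) (by simp)).clm_apply contDiff_const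

theorem pderiv_add {N : ℕ} (i : Fin N) {f g : EuclideanSpace ℝ (Fin N) → ℂ}
    (hf : ContDiff ℝ (⊤ : ℕ∞) f) (hg : ContDiff ℝ (⊤ : ℕ∞) g) :
    pderiv i (f + g) = pderiv i f + pderiv i g := by
  funext x
  have hf' := (hf.differentiable (by simp)).differentiableAt (x := x)
  have hg' := (hg.differentiable (by simp)).differentiableAt (x := x)
  simp only [pderiv, Pi.add_apply]
  rw [(hf'.add hg').lineDeriv_eq_fderiv, hf'.lineDeriv_eq_fderiv, hg'.lineDeriv_eq_fderiv,
    fderiv_add hf' hg']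
  rfl

theorem pderiv_smul {N : ℕ} (i : Fin N) (c : ℂ) {f : EuclideanSpace ℝ (Fin N) → ℂ}
    (hf : ContDiff ℝ (⊤ : ℕ∞) f) : pderiv i (c • f) = c • pderiv i f := by
  funext x
  have hf' := (hf.differentiable (by simp)).differentiableAt (x := x)
  simp only [pderiv, Pi.smul_apply]
  rw [(hf'.const_smul c).lineDeriv_eq_fderiv, hf'.lineDeriv_eq_fderiv, fderiv_const_smul hf' c]
  rfl

theorem pderiv_iterate {N : ℕ} (i : Fin N) (k : ℕ) {f g : EuclideanSpace ℝ (Fin N) → ℂ} (c : ℂ)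
    (hf : ContDiff ℝ (⊤ : ℕ∞) f) (hg : ContDiff ℝ (⊤ : ℕ∞) g) :
    ContDiff ℝ (⊤ : ℕ∞) ((pderiv i)^[k] f) ∧
    (pderiv i)^[k] (f + g) = (pderiv i)^[k] f + (pderiv i)^[k] g ∧
    (pderiv i)^[k] (c • f) = c • (pderiv i)^[k] f := by
  induction k generalizing f g with
  | zero => exact ⟨hf, rfl, rfl⟩
  | succ k ih =>
    have := ih (contDiff_pderiv i hf) (contDiff_pderiv i hg)
    simp only [Function.iterate_succ, Function.comp_apply]
    rw [pderiv_add i hf hg, pderiv_smul i c hf]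
    exact this

theorem mderiv_linear {N : ℕ} (α : Fin N → ℕ) {f g : EuclideanSpace ℝ (Fin N) → ℂ} (c : ℂ)
    (hf : ContDiff ℝ (⊤ : ℕ∞) f) (hg : ContDiff ℝ (⊤ : ℕ∞) g) :
    mderiv α (f + g) = mderiv α f + mderiv α g ∧ mderiv α (c • f) = c • mderiv α f := by
  have key : ∀ l : List (Fin N),
      ContDiff ℝ (⊤ : ℕ∞) (l.foldr (fun i h => (pderiv i)^[α i] h) f) ∧
      ContDiff ℝ (⊤ : ℕ∞) (l.foldr (fun i h => (pderiv i)^[α i] h) g) ∧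
      l.foldr (fun i h => (pderiv i)^[α i] h) (f + g) =
        l.foldr (fun i h => (pderiv i)^[α i] h) f + l.foldr (fun i h => (pderiv i)^[α i] h) g ∧
      l.foldr (fun i h => (pderiv i)^[α i] h) (c • f) =
        c • l.foldr (fun i h => (pderiv i)^[α i] h) f := by
    intro l
    induction l with
    | nil => exact ⟨hf, hg, rfl, rfl⟩
    | cons i l ih =>
      obtain ⟨h1, h2, h3, h4⟩ := ih
      have a := pderiv_iterate i (α i) c h1 h2
      have b := pderiv_iterate i (α i) c h2 h1
      simp only [List.foldr_cons]
      rw [h3, h4]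
      exact ⟨a.1, b.1, a.2.1, a.2.2⟩
  exact (key _).2.2

/-- The set `O_{M,ω}(ℝ^N)` as a linear subspace of the space of all functions. -/
def OMSpace (N : ℕ) {ω : ℝ → ℝ} (hω : IsNonQuasianalyticWeight ω) :
    Submodule ℂ (EuclideanSpace ℝ (Fin N) → ℂ) where
  carrier := OMSet N ω
  zero_mem' := by
    refine ⟨contDiff_const, fun m _ => ⟨1, one_pos, 1, le_rfl, fun α x => ?_⟩⟩
    have h := (mderiv_linear α (f := (0 : EuclideanSpace ℝ (Fin N) → ℂ)) (g := 0) 0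
      contDiff_const contDiff_const).2
    rw [zero_smul, zero_smul] at h
    simp [h]
  add_mem' := by
    rintro f g ⟨hf, hf'⟩ ⟨hg, hg'⟩
    refine ⟨hf.add hg, fun m hm => ?_⟩
    obtain ⟨C, hC, n, hn, h⟩ := hf' m hm
    obtain ⟨D, hD, k, hk, h'⟩ := hg' m hm
    refine ⟨C + D, add_pos hC hD, max n k, le_max_of_le_left hn, fun α x => ?_⟩
    have mono : ∀ j : ℕ, j ≤ max n k →
        EReal.exp ((((j : ℝ) * ω ‖x‖ : ℝ) : EReal) + youngWeight ω m α) ≤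
        EReal.exp (((((max n k : ℕ) : ℝ) * ω ‖x‖ : ℝ) : EReal) + youngWeight ω m α) := by
      intro j hj
      apply EReal.exp_monotone
      apply add_le_add_left
      apply EReal.coe_le_coe_iff.2
      exact mul_le_mul_of_nonneg_right (by exact_mod_cast hj) (hω.nonneg _ (norm_nonneg x))
    rw [(mderiv_linear α 0 hf hg).1, ENNReal.ofReal_add hC.le hD.le, add_mul]
    refine (enorm_add_le _ _).trans (add_le_add ((h α x).trans ?_) ((h' α x).trans ?_))
    · exact mul_le_mul' le_rfl (mono n (le_max_left _ _))
    · exact mul_le_mul' le_rfl (mono k (le_max_right _ _))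
  smul_mem' := by
    rintro c f ⟨hf, hf'⟩
    refine ⟨hf.const_smul c, fun m hm => ?_⟩
    obtain ⟨C, hC, n, hn, h⟩ := hf' m hm
    refine ⟨(‖c‖ + 1) * C, by positivity, n, hn, fun α x => ?_⟩
    rw [(mderiv_linear α c hf hf).2, Pi.smul_apply, enorm_smul, ENNReal.ofReal_mul (by positivity),
      mul_assoc]
    refine mul_le_mul' ?_ (h α x)
    rw [← ofReal_norm]
    exact ENNReal.ofReal_le_ofReal (by linarith)

/-- The topology `τ` on `O_{M,ω}(ℝ^N)` generated by the system `{q_{m,g}}`, `m ≥ 1`,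
`g ∈ S_ω(ℝ^N)`: the coarsest topology in which all the balls of all the `q_{m,g}` are open. -/
@[reducible] def tauTopology (N : ℕ) {ω : ℝ → ℝ} (hω : IsNonQuasianalyticWeight ω) :
    TopologicalSpace (OMSpace N hω) :=
  TopologicalSpace.generateFrom
    {U | ∃ m : ℕ, 1 ≤ m ∧ ∃ g ∈ SSpace N ω, ∃ f₀ : OMSpace N hω, ∃ ε : ℝ, 0 < ε ∧
      U = {f | qNorm ω m g ((f - f₀ : OMSpace N hω) : EuclideanSpace ℝ (Fin N) → ℂ) <
        ENNReal.ofReal ε}}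

/-! ### Growth of weight functions -/

namespace IsNonQuasianalyticWeight

variable {ω : ℝ → ℝ}

/-! Everything rests on a supply of functions in `SSpace` that are large where prescribed. They are
series `∑ c_j exp(-|x - y_j|²/2)` with `c_j ≥ 0` and `∑ c_j exp(l ω(y_j)) < ∞` for every `l ≥ 0`.
Positivity rules out cancellation, so each single term bounds the sum from below. Membership in
`SSpace` uses three consequences of the axioms: (β) and monotonicity give `ω(t) = O(1 + t)`, so a
Gaussian beats every `exp(l ω)`; (α) gives `ω(s + t) ≤ K(1 + ω(s) + ω(t))`, so translating by `y_j`
costs only a power of `exp(ω(y_j))`; on the Fourier side translations become modulations, whose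
derivatives cost powers of `1 + |y_j|`, and (γ) absorbs these.

If the estimate defining `OMSet` fails for some `m`, there are `α_j`, `x_j` violating it with
constants growing in `j`. A Gaussian series centred at the `x_j` then makes `q_{m,g}(f)` infinite.
The other implication follows directly from the decay of `g`.

For the topology, finitely many `q_{m_i,g_i}` are dominated by one `q_{m,g}` with `g` free of zeros:
`m φ*(s/m)` decreases in `m`, and a Gaussian series centred at lattice points dominates `∑ |g_i|`
plus a Gaussian (`exists_mem_SSpace_le_norm`). -/

theorem exists_add_le (hω : IsNonQuasianalyticWeight ω) :
    ∃ K : ℝ, 1 ≤ K ∧ ∀ s t, 0 ≤ s → 0 ≤ t → ω (s + t) ≤ K * (1 + ω s + ω t) := by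
  obtain ⟨K, hK, h⟩ := hω.alpha
  refine ⟨K, hK, fun s t hs ht => ?_⟩
  have key : ∀ a b, 0 ≤ a → a ≤ b → ω (a + b) ≤ K * (1 + ω a + ω b) := by
    intro a b ha hab
    have hb := ha.trans hab
    have h1 : ω (a + b) ≤ ω (2 * b) :=
      hω.monotoneOn (Set.mem_Ici.2 (by linarith)) (Set.mem_Ici.2 (by linarith)) (by linarith)
    have h2 := h b hb
    have h3 := mul_nonneg (by linarith : (0 : ℝ) ≤ K) (hω.nonneg a ha)
    linarith
  rcases le_total s t with hst | hst
  · exact key s t hs hst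
  · have := key t s ht hst
    rw [add_comm s t]
    linarith

/-- On `(T, 2T]` with `T ≥ 1` the integrand of (β) is at least `ω(T)/(5T²)`, because `1 + t² ≤ 5T²`.
Integrating over this interval of length `T` bounds `ω(T)/(5T)` by the full integral. -/
theorem exists_le_linear (hω : IsNonQuasianalyticWeight ω) :
    ∃ A : ℝ, 0 ≤ A ∧ ∀ t, 0 ≤ t → ω t ≤ A * (1 + t) := by
  set I := ∫ t in Set.Ioi (1 : ℝ), ω t / (1 + t ^ 2) with hI
  have hnn : ∀ t ∈ Set.Ioi (1 : ℝ), 0 ≤ ω t / (1 + t ^ 2) := fun t ht =>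
    div_nonneg (hω.nonneg t (by linarith [Set.mem_Ioi.1 ht])) (by positivity)
  have hI0 : 0 ≤ I := MeasureTheory.setIntegral_nonneg measurableSet_Ioi hnn
  have key : ∀ T, 1 ≤ T → ω T ≤ 5 * I * T := by
    intro T hT
    have hω0 := hω.nonneg T (by linarith)
    have hsub : Set.Ioc T (2 * T) ⊆ Set.Ioi 1 := fun t ht => lt_of_le_of_lt hT ht.1
    have h1 : ∫ t in Set.Ioc T (2 * T), ω t / (1 + t ^ 2) ≤ I :=
      MeasureTheory.setIntegral_mono_set hω.beta
        ((MeasureTheory.ae_restrict_iff' measurableSet_Ioi).2 (Filter.Eventually.of_forall hnn))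
        (Filter.Eventually.of_forall hsub)
    have h2 : ∫ t in Set.Ioc T (2 * T), ω T / (5 * T ^ 2) ≤
        ∫ t in Set.Ioc T (2 * T), ω t / (1 + t ^ 2) := by
      refine MeasureTheory.setIntegral_mono_on (by simp) (hω.beta.mono_set hsub)
        measurableSet_Ioc fun t ht => ?_
      refine div_le_div₀ (hω.nonneg t (by linarith [ht.1])) ?_ (by positivity) ?_
      · exact hω.monotoneOn (Set.mem_Ici.2 (by linarith)) (Set.mem_Ici.2 (by linarith [ht.1]))
          ht.1.le
      · nlinarith [ht.1, ht.2]
    rw [MeasureTheory.setIntegral_const] at h2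
    have h3 : MeasureTheory.volume.real (Set.Ioc T (2 * T)) = T := by
      rw [Real.volume_real_Ioc_of_le (by linarith)]; ring
    rw [h3, smul_eq_mul] at h2
    have h4 : T * (ω T / (5 * T ^ 2)) = ω T / (5 * T) := by
      have : T ≠ 0 := by positivity
      field_simp
    rw [h4] at h2
    have := (div_le_iff₀ (by positivity)).1 (h2.trans h1)
    linarith
  refine ⟨5 * I, by positivity, fun t ht => ?_⟩
  have h1 : ω t ≤ ω (1 + t) :=
    hω.monotoneOn (Set.mem_Ici.2 ht) (Set.mem_Ici.2 (by linarith)) (by linarith)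
  exact h1.trans (key (1 + t) (by linarith))

theorem exists_pow_le_exp (hω : IsNonQuasianalyticWeight ω) (n : ℕ) :
    ∃ C l : ℝ, 0 < C ∧ 0 ≤ l ∧ ∀ t, 0 ≤ t → (1 + t) ^ n ≤ C * Real.exp (l * ω t) := by
  obtain ⟨a, b, hb, h⟩ := hω.gamma
  refine ⟨Real.exp (-(n * a / b)), n / b, Real.exp_pos _, by positivity, fun t ht => ?_⟩
  have h1 : (1 + t) ^ n = Real.exp (n * Real.log (1 + t)) := by
    rw [Real.exp_nat_mul, Real.exp_log (by linarith)]
  rw [h1, ← Real.exp_add, Real.exp_le_exp]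
  have h2 : Real.log (1 + t) ≤ (ω t - a) / b := by
    rw [le_div_iff₀ hb]
    linarith [h t ht]
  calc n * Real.log (1 + t) ≤ n * ((ω t - a) / b) := by gcongr
    _ = _ := by ring

theorem exists_exp_mul_pow_mul_gaussian_le (hω : IsNonQuasianalyticWeight ω) (l : ℝ) (hl : 0 ≤ l)
    (n : ℕ) :
    ∃ B : ℝ, 0 ≤ B ∧
      ∀ t, 0 ≤ t → Real.exp (l * ω t) * ((1 + t) ^ n * Real.exp (-(t ^ 2 / 2))) ≤ B := by
  obtain ⟨A, hA, h⟩ := hω.exists_le_linear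
  -- With `a = l A + n` the exponent is at most `a(1 + t) - t²/2`; completing the square gives the
  -- maximum `a + a²/2`.
  refine ⟨Real.exp ((l * A + n) + (l * A + n) ^ 2 / 2), (Real.exp_pos _).le, fun t ht => ?_⟩
  have h1 : (1 + t) ^ n ≤ Real.exp (n * (1 + t)) := by
    rw [Real.exp_nat_mul]
    exact pow_le_pow_left₀ (by linarith) (by linarith [Real.add_one_le_exp (1 + t)]) n
  calc _ ≤ Real.exp (l * ω t) * (Real.exp (n * (1 + t)) * Real.exp (-(t ^ 2 / 2))) := by gcongr
    _ = Real.exp (l * ω t + (n * (1 + t) + -(t ^ 2 / 2))) := by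
      rw [Real.exp_add, Real.exp_add]
    _ ≤ _ := by
      rw [Real.exp_le_exp]
      have := mul_le_mul_of_nonneg_left (h t ht) hl
      nlinarith [sq_nonneg (t - (l * A + n))]

end IsNonQuasianalyticWeight

/-! ### Partial derivatives and the Fréchet derivative -/

section Derivatives

variable {N : ℕ}

theorem norm_iteratedFDeriv_pderiv_le (i : Fin N) {f : EuclideanSpace ℝ (Fin N) → ℂ}
    (hf : ContDiff ℝ (⊤ : ℕ∞) f) (n : ℕ) (x : EuclideanSpace ℝ (Fin N)) :
    ‖iteratedFDeriv ℝ n (pderiv i f) x‖ ≤ ‖iteratedFDeriv ℝ (n + 1) f x‖ := by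
  have h : pderiv i f =
      ContinuousLinearMap.apply ℝ ℂ (EuclideanSpace.single i (1 : ℝ)) ∘ fderiv ℝ f := by
    funext y
    exact (hf.differentiable (by simp)).differentiableAt.lineDeriv_eq_fderiv
  have hd : ContDiff ℝ (⊤ : ℕ∞) (fderiv ℝ f) :=
    hf.fderiv_right (m := ((⊤ : ℕ∞) : WithTop ℕ∞)) (by simp)
  rw [h, ← norm_iteratedFDeriv_fderiv]
  refine (ContinuousLinearMap.norm_iteratedFDeriv_comp_left _ hd.contDiffAt
    (mod_cast le_top)).trans ?_
  refine mul_le_of_le_one_left (norm_nonneg _)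
    (ContinuousLinearMap.opNorm_le_bound _ zero_le_one fun L => ?_)
  simpa using L.le_opNorm (EuclideanSpace.single i (1 : ℝ))

theorem norm_iteratedFDeriv_pderiv_iterate_le (i : Fin N) (k : ℕ)
    {f : EuclideanSpace ℝ (Fin N) → ℂ} (hf : ContDiff ℝ (⊤ : ℕ∞) f) (n : ℕ)
    (x : EuclideanSpace ℝ (Fin N)) :
    ‖iteratedFDeriv ℝ n ((pderiv i)^[k] f) x‖ ≤ ‖iteratedFDeriv ℝ (n + k) f x‖ := by
  induction k generalizing f with
  | zero => rfl
  | succ k ih =>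
    exact (ih (contDiff_pderiv i hf)).trans (norm_iteratedFDeriv_pderiv_le i hf (n + k) x)

/-- Each partial derivative evaluates one slot of the Fréchet derivative at a unit vector. Hence the
series can be estimated through `iteratedFDeriv` alone. -/
theorem norm_mderiv_le (α : Fin N → ℕ) {f : EuclideanSpace ℝ (Fin N) → ℂ}
    (hf : ContDiff ℝ (⊤ : ℕ∞) f) (x : EuclideanSpace ℝ (Fin N)) :
    ‖mderiv α f x‖ ≤ ‖iteratedFDeriv ℝ (multiLength α) f x‖ := by
  have key : ∀ l : List (Fin N),
      ContDiff ℝ (⊤ : ℕ∞) (l.foldr (fun i h => (pderiv i)^[α i] h) f) ∧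
      ∀ n, ‖iteratedFDeriv ℝ n (l.foldr (fun i h => (pderiv i)^[α i] h) f) x‖ ≤
        ‖iteratedFDeriv ℝ (n + (l.map α).sum) f x‖ := by
    intro l
    induction l with
    | nil => exact ⟨hf, fun n => le_rfl⟩
    | cons i l ih =>
      refine ⟨(pderiv_iterate i (α i) 0 ih.1 ih.1).1, fun n => ?_⟩
      refine (norm_iteratedFDeriv_pderiv_iterate_le i (α i) ih.1 n x).trans ?_
      refine (ih.2 (n + α i)).trans_eq ?_
      rw [List.map_cons, List.sum_cons, add_assoc]
  have h := (key (List.finRange N)).2 0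
  rw [norm_iteratedFDeriv_zero, zero_add] at h
  rwa [multiLength, ← List.sum_ofFn, List.ofFn_eq_map]

theorem mderiv_zero_index (f : EuclideanSpace ℝ (Fin N) → ℂ) :
    mderiv (0 : Fin N → ℕ) f = f := by
  unfold mderiv
  induction List.finRange N with
  | nil => rfl
  | cons i l ih => exact ih

end Derivatives

/-! ### Modulated Gaussians -/

section Gaussian

variable {E : Type*} [NormedAddCommGroup E] [InnerProductSpace ℝ E]

theorem contDiff_cexp_real : ContDiff ℝ (⊤ : ℕ∞) Complex.exp :=
  Complex.contDiff_exp

theorem norm_iteratedFDeriv_cexp_le (n : ℕ) (z : ℂ) :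
    ‖iteratedFDeriv ℝ n Complex.exp z‖ ≤ Real.exp z.re := by
  induction n with
  | zero => rw [norm_iteratedFDeriv_zero, Complex.norm_exp]
  | succ n ih =>
    have h : fderiv ℝ Complex.exp = ContinuousLinearMap.mul ℝ ℂ ∘ Complex.exp := by
      funext w
      have := ((Complex.hasDerivAt_exp w).hasFDerivAt.restrictScalars ℝ).fderiv
      rw [this]
      ext; simp [mul_comm]
    rw [← norm_iteratedFDeriv_fderiv, h]
    refine (ContinuousLinearMap.norm_iteratedFDeriv_comp_left _ contDiff_cexp_real.contDiffAt
      (mod_cast le_top)).trans ?_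
    exact (mul_le_of_le_one_left (norm_nonneg _) (ContinuousLinearMap.opNorm_mul_le ℝ ℂ)).trans ih

/-- The exponent `-|x|²/2 - i⟨y, x⟩`. -/
noncomputable def gaussianPhase (y x : E) : ℂ :=
  -((‖x‖ ^ 2 / 2 : ℝ) : ℂ) - Complex.I * ((inner ℝ y x : ℝ) : ℂ)

/-- The modulated Gaussian `exp(-|x|²/2 - i⟨y, x⟩)`. -/
noncomputable def modGaussian (y x : E) : ℂ := Complex.exp (gaussianPhase y x)

theorem norm_modGaussian (y x : E) : ‖modGaussian y x‖ = Real.exp (-(‖x‖ ^ 2 / 2)) := by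
  rw [modGaussian, Complex.norm_exp, gaussianPhase, Complex.sub_re, Complex.neg_re,
    Complex.ofReal_re, Complex.re_mul_ofReal]
  simp

theorem modGaussian_zero (x : E) :
    modGaussian 0 x = ((Real.exp (-(‖x‖ ^ 2 / 2)) : ℝ) : ℂ) := by
  simp [modGaussian, gaussianPhase]

theorem hasFDerivAt_gaussianPhase (y x : E) :
    HasFDerivAt (gaussianPhase y)
      (-(Complex.ofRealCLM ∘L innerSL ℝ x) - Complex.I • (Complex.ofRealCLM ∘L innerSL ℝ y)) x := by
  have h1 : HasFDerivAt (fun z : E => ‖z‖ ^ 2 / 2) (innerSL ℝ x) x := by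
    have := (hasStrictFDerivAt_norm_sq x).hasFDerivAt.mul_const (2⁻¹ : ℝ)
    refine (this.congr_fderiv ?_)
    ext v
    simp
  have h2 : HasFDerivAt (fun z : E => ((‖z‖ ^ 2 / 2 : ℝ) : ℂ))
      (Complex.ofRealCLM ∘L innerSL ℝ x) x := Complex.ofRealCLM.hasFDerivAt.comp x h1
  have h3 : HasFDerivAt (fun z : E => ((inner ℝ y z : ℝ) : ℂ))
      (Complex.ofRealCLM ∘L innerSL ℝ y) x :=
    Complex.ofRealCLM.hasFDerivAt.comp x (innerSL ℝ y).hasFDerivAt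
  exact h2.neg.sub (h3.const_smul Complex.I)

theorem contDiff_gaussianPhase (y : E) : ContDiff ℝ (⊤ : ℕ∞) (gaussianPhase y) := by
  unfold gaussianPhase
  refine ContDiff.sub (ContDiff.neg ?_) (ContDiff.mul contDiff_const ?_)
  · exact Complex.ofRealCLM.contDiff.comp ((contDiff_norm_sq ℝ).div_const 2)
  · exact Complex.ofRealCLM.contDiff.comp (innerSL ℝ y).contDiff

theorem contDiff_modGaussian (y : E) : ContDiff ℝ (⊤ : ℕ∞) (modGaussian y) :=
  contDiff_cexp_real.comp (contDiff_gaussianPhase y)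

/-- The phase is a quadratic polynomial: its first derivative is affine in `x`, its second is
constant of norm at most 1, and the higher ones vanish. The form `D ^ i` is what the Faà di Bruno
estimate `norm_iteratedFDeriv_comp_le` requires. -/
theorem norm_iteratedFDeriv_gaussianPhase_le (y x : E) {i : ℕ} (hi : 1 ≤ i) :
    ‖iteratedFDeriv ℝ i (gaussianPhase y) x‖ ≤ (1 + ‖x‖ + ‖y‖) ^ i := by
  set c : E →L[ℝ] ℂ := -(Complex.I • (Complex.ofRealCLM ∘L innerSL ℝ y)) with hc
  set L : E →L[ℝ] E →L[ℝ] ℂ :=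
    -((ContinuousLinearMap.compL ℝ E ℝ ℂ Complex.ofRealCLM) ∘L innerSL ℝ) with hL
  have hfd : fderiv ℝ (gaussianPhase y) = fun z => L z + c := by
    funext z
    rw [(hasFDerivAt_gaussianPhase y z).fderiv]
    ext v
    simp [hL, hc, sub_eq_add_neg]
    rfl
  have hLx : ∀ z, ‖L z‖ ≤ ‖z‖ := fun z => by
    refine ContinuousLinearMap.opNorm_le_bound _ (norm_nonneg _) fun v => ?_
    have h : ‖L z v‖ = |inner ℝ z v| := by
      simp [hL]
      rfl
    exact h.trans_le (abs_real_inner_le_norm z v)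
  have hcn : ‖c‖ ≤ ‖y‖ := by
    refine ContinuousLinearMap.opNorm_le_bound _ (norm_nonneg _) fun v => ?_
    have := abs_real_inner_le_norm y v
    simpa [hc] using this
  have hL1 : ‖L‖ ≤ 1 := ContinuousLinearMap.opNorm_le_bound _ zero_le_one fun z => by
    simpa using hLx z
  have hx := norm_nonneg x
  have hy := norm_nonneg y
  obtain ⟨i, rfl⟩ := Nat.exists_eq_add_of_le' hi
  rw [← norm_iteratedFDeriv_fderiv, hfd]
  rcases i with _ | i
  · rw [norm_iteratedFDeriv_zero, zero_add, pow_one]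
    linarith [norm_add_le (L x) c, hLx x]
  · have h2 : fderiv ℝ (fun z => L z + c) = fun _ => L := by
      funext z
      exact (L.hasFDerivAt.add_const c).fderiv
    rw [← norm_iteratedFDeriv_fderiv, h2]
    have hge : (1 : ℝ) ≤ (1 + ‖x‖ + ‖y‖) ^ (i + 1 + 1) := one_le_pow₀ (by linarith)
    rcases i with _ | i
    · rw [norm_iteratedFDeriv_zero]
      exact hL1.trans hge
    · rw [iteratedFDeriv_const_of_ne (by simp)]
      simpa using zero_le_one.trans hge

theorem norm_iteratedFDeriv_modGaussian_le (y x : E) (n : ℕ) :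
    ‖iteratedFDeriv ℝ n (modGaussian y) x‖ ≤
      n.factorial * (1 + ‖y‖) ^ n * ((1 + ‖x‖) ^ n * Real.exp (-(‖x‖ ^ 2 / 2))) := by
  have h := norm_iteratedFDeriv_comp_le (n := n) contDiff_cexp_real (contDiff_gaussianPhase y)
    (mod_cast le_top) x (C := Real.exp (-(‖x‖ ^ 2 / 2))) (D := 1 + ‖x‖ + ‖y‖)
    (fun i _ => (norm_iteratedFDeriv_cexp_le i _).trans_eq (by
      rw [← norm_modGaussian y x, modGaussian, Complex.norm_exp]))
    (fun i hi _ => norm_iteratedFDeriv_gaussianPhase_le y x hi)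
  refine h.trans ?_
  have hx := norm_nonneg x
  have hy := norm_nonneg y
  -- Separating `x` from `y` lets the Gaussian absorb the powers of `1 + ‖x‖` and the coefficients
  -- of the series those of `1 + ‖y‖`.
  calc (n.factorial : ℝ) * Real.exp (-(‖x‖ ^ 2 / 2)) * (1 + ‖x‖ + ‖y‖) ^ n
      ≤ n.factorial * Real.exp (-(‖x‖ ^ 2 / 2)) * ((1 + ‖y‖) * (1 + ‖x‖)) ^ n := by
        gcongr
        nlinarith [mul_nonneg hx hy]
    _ = _ := by rw [mul_pow]; ring

theorem modGaussian_eq (y x : E) :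
    modGaussian y x =
      Complex.exp (-(1 / 2 : ℂ) * (‖x‖ : ℂ) ^ 2 + -Complex.I * ((inner ℝ y x : ℝ) : ℂ)) := by
  rw [modGaussian, gaussianPhase]
  congr 1
  push_cast
  ring

variable [FiniteDimensional ℝ E] [MeasurableSpace E] [BorelSpace E]

theorem integrable_modGaussian (y : E) : MeasureTheory.Integrable (modGaussian y) := by
  have := GaussianFourier.integrable_cexp_neg_mul_sq_norm_add (b := 1 / 2) (V := E) (by norm_num)
    (-Complex.I) y
  exact this.congr (Filter.Eventually.of_forall fun x => (modGaussian_eq y x).symm)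

theorem integral_modGaussian (y : E) :
    ∫ x, modGaussian y x =
      (2 * Real.pi : ℂ) ^ ((Module.finrank ℝ E : ℂ) / 2) * modGaussian 0 y := by
  simp_rw [modGaussian_eq y]
  rw [GaussianFourier.integral_cexp_neg_mul_sq_norm_add (by norm_num), modGaussian_eq]
  congr 2
  · ring
  · simp; ring

end Gaussian

/-! ### Series of translated Gaussians -/

section Series

variable {N : ℕ} {ω : ℝ → ℝ} {ι : Type*}

theorem contDiff_tsum_and_decay {F : ι → EuclideanSpace ℝ (Fin N) → ℂ}
    (hF : ∀ j, ContDiff ℝ (⊤ : ℕ∞) (F j))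
    (h : ∀ (k : ℕ) (l : ℝ), 0 ≤ l → ∃ u : ι → ℝ, Summable u ∧
      ∀ j x, Real.exp (l * ω ‖x‖) * ‖iteratedFDeriv ℝ k (F j) x‖ ≤ u j) :
    ContDiff ℝ (⊤ : ℕ∞) (fun x => ∑' j, F j x) ∧
      ∀ l : ℝ, 0 ≤ l → ∀ α : Fin N → ℕ, ∃ C : ℝ, ∀ x,
        Real.exp (l * ω ‖x‖) * ‖mderiv α (fun x => ∑' j, F j x) x‖ ≤ C := by
  -- The case `l = 0` gives the unweighted uniform bounds needed for termwise differentiation.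
  choose v hv hvb using fun k => h k 0 le_rfl
  have hvb' : ∀ (k : ℕ) (j : ι) (x : EuclideanSpace ℝ (Fin N)), (k : ℕ∞) ≤ ⊤ →
      ‖iteratedFDeriv ℝ k (F j) x‖ ≤ v k j := fun k j x _ => by simpa using hvb k j x
  have hsm : ContDiff ℝ (⊤ : ℕ∞) (fun x => ∑' j, F j x) :=
    contDiff_tsum hF (fun k _ => hv k) hvb'
  refine ⟨hsm, fun l hl α => ?_⟩
  obtain ⟨u, hu, hub⟩ := h (multiLength α) l hl
  refine ⟨∑' j, u j, fun x => ?_⟩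
  have hpos := Real.exp_pos (l * ω ‖x‖)
  have hsum : Summable fun j => ‖iteratedFDeriv ℝ (multiLength α) (F j) x‖ :=
    Summable.of_nonneg_of_le (fun _ => norm_nonneg _) (fun j => hvb' _ j x le_top) (hv _)
  calc Real.exp (l * ω ‖x‖) * ‖mderiv α (fun x => ∑' j, F j x) x‖
      ≤ Real.exp (l * ω ‖x‖) *
          ‖iteratedFDeriv ℝ (multiLength α) (fun x => ∑' j, F j x) x‖ := by
        gcongr
        exact norm_mderiv_le α hsm x
    _ = Real.exp (l * ω ‖x‖) * ‖∑' j, iteratedFDeriv ℝ (multiLength α) (F j) x‖ := by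
        rw [iteratedFDeriv_tsum hF (fun k _ => hv k) hvb' le_top]
    _ ≤ Real.exp (l * ω ‖x‖) * ∑' j, ‖iteratedFDeriv ℝ (multiLength α) (F j) x‖ := by
        gcongr
        exact norm_tsum_le_tsum_norm hsum
    _ = ∑' j, Real.exp (l * ω ‖x‖) * ‖iteratedFDeriv ℝ (multiLength α) (F j) x‖ := by
        rw [tsum_mul_left]
    _ ≤ ∑' j, u j := (hsum.mul_left _).tsum_le_tsum (fun j => hub j x) hu

/-- The series `∑ c_j exp(-|x - y_j|²/2)`. -/
noncomputable def gaussianSeries (c : ι → ℝ) (y : ι → EuclideanSpace ℝ (Fin N))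
    (x : EuclideanSpace ℝ (Fin N)) : ℂ :=
  ∑' j, (c j : ℂ) * modGaussian 0 (x - y j)

theorem norm_iteratedFDeriv_const_mul (c : ℝ) (hc : 0 ≤ c) {f : EuclideanSpace ℝ (Fin N) → ℂ}
    (hf : ContDiff ℝ (⊤ : ℕ∞) f) (k : ℕ) (x : EuclideanSpace ℝ (Fin N)) :
    ‖iteratedFDeriv ℝ k (fun x => (c : ℂ) * f x) x‖ = c * ‖iteratedFDeriv ℝ k f x‖ := by
  have h : (fun x => (c : ℂ) * f x) = (c : ℂ) • f := rfl
  rw [h, iteratedFDeriv_const_smul_apply (hf.of_le (mod_cast le_top)).contDiffAt, norm_smul,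
    Complex.norm_real, Real.norm_of_nonneg hc]

theorem le_norm_gaussianSeries {c : ι → ℝ} (y : ι → EuclideanSpace ℝ (Fin N))
    (hc : ∀ j, 0 ≤ c j) (hs : Summable c) (j : ι) (x : EuclideanSpace ℝ (Fin N)) :
    c j * Real.exp (-(‖x - y j‖ ^ 2 / 2)) ≤ ‖gaussianSeries c y x‖ := by
  have hnn : ∀ j, 0 ≤ c j * Real.exp (-(‖x - y j‖ ^ 2 / 2)) := fun j =>
    mul_nonneg (hc j) (Real.exp_pos _).le
  have hsum : Summable fun j => c j * Real.exp (-(‖x - y j‖ ^ 2 / 2)) :=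
    Summable.of_nonneg_of_le hnn (fun j => mul_le_of_le_one_right (hc j)
      (Real.exp_le_one_iff.2 (by have := sq_nonneg ‖x - y j‖; linarith))) hs
  have h : gaussianSeries c y x =
      ((∑' j, c j * Real.exp (-(‖x - y j‖ ^ 2 / 2)) : ℝ) : ℂ) := by
    rw [gaussianSeries, Complex.ofReal_tsum]
    simp_rw [modGaussian_zero, Complex.ofReal_mul]
  rw [h, Complex.norm_real, Real.norm_of_nonneg (tsum_nonneg hnn)]
  exact hsum.le_tsum j fun i _ => hnn i

theorem gaussianSeries_contDiff_and_decay (hω : IsNonQuasianalyticWeight ω) {c : ι → ℝ}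
    {y : ι → EuclideanSpace ℝ (Fin N)} (hc : ∀ j, 0 ≤ c j)
    (hs : ∀ l : ℝ, 0 ≤ l → Summable fun j => c j * Real.exp (l * ω ‖y j‖)) :
    ContDiff ℝ (⊤ : ℕ∞) (gaussianSeries c y) ∧
      ∀ l : ℝ, 0 ≤ l → ∀ α : Fin N → ℕ, ∃ C : ℝ, ∀ x,
        Real.exp (l * ω ‖x‖) * ‖mderiv α (gaussianSeries c y) x‖ ≤ C := by
  have hsm : ∀ j, ContDiff ℝ (⊤ : ℕ∞) fun x => modGaussian (0 : EuclideanSpace ℝ (Fin N))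
      (x - y j) := fun j => (contDiff_modGaussian 0).comp (contDiff_id.sub contDiff_const)
  refine contDiff_tsum_and_decay (fun j => contDiff_const.mul (hsm j)) fun k l hl => ?_
  obtain ⟨K, hK, hadd⟩ := hω.exists_add_le
  have hlK : 0 ≤ l * K := mul_nonneg hl (by linarith)
  obtain ⟨B, hB, hBb⟩ := hω.exists_exp_mul_pow_mul_gaussian_le (l * K) hlK k
  refine ⟨fun j => (c j * Real.exp (l * K * ω ‖y j‖)) * (Real.exp (l * K) * (k.factorial * B)),
    (hs _ hlK).mul_right _, fun j x => ?_⟩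
  rw [norm_iteratedFDeriv_const_mul _ (hc j) (hsm j), iteratedFDeriv_comp_sub]
  have h1 : Real.exp (l * ω ‖x‖) ≤ Real.exp (l * K * ω ‖y j‖) * Real.exp (l * K) *
      Real.exp (l * K * ω ‖x - y j‖) := by
    rw [← Real.exp_add, ← Real.exp_add, Real.exp_le_exp]
    have h2 : ω ‖x‖ ≤ ω (‖x - y j‖ + ‖y j‖) := hω.monotoneOn (norm_nonneg _)
      (Set.mem_Ici.2 (by positivity)) (by simpa using norm_add_le (x - y j) (y j))
    have h3 := hadd _ _ (norm_nonneg (x - y j)) (norm_nonneg (y j))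
    have := mul_le_mul_of_nonneg_left (h2.trans h3) hl
    linarith
  have h4 : ‖iteratedFDeriv ℝ k (modGaussian 0) (x - y j)‖ ≤ k.factorial *
      ((1 + ‖x - y j‖) ^ k * Real.exp (-(‖x - y j‖ ^ 2 / 2))) := by
    simpa using norm_iteratedFDeriv_modGaussian_le 0 (x - y j) k
  have hcj := hc j
  calc _ ≤ Real.exp (l * K * ω ‖y j‖) * Real.exp (l * K) * Real.exp (l * K * ω ‖x - y j‖) *
        (c j * (k.factorial *
          ((1 + ‖x - y j‖) ^ k * Real.exp (-(‖x - y j‖ ^ 2 / 2))))) := by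
        gcongr
    _ = (c j * Real.exp (l * K * ω ‖y j‖)) * (Real.exp (l * K) * (k.factorial *
        (Real.exp (l * K * ω ‖x - y j‖) *
          ((1 + ‖x - y j‖) ^ k * Real.exp (-(‖x - y j‖ ^ 2 / 2)))))) := by ring
    _ ≤ _ := by
        beta_reduce
        gcongr
        exact hBb _ (norm_nonneg _)

/-- This series is, up to a constant, the Fourier transform of `gaussianSeries c y`. All its
Gaussians are centred at the origin, so they absorb `exp(l ω)` themselves; only the frequencies
`y_j` must be paid for by the coefficients. -/
theorem modGaussianSeries_contDiff_and_decay (hω : IsNonQuasianalyticWeight ω) {c : ι → ℝ}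
    {y : ι → EuclideanSpace ℝ (Fin N)} (hc : ∀ j, 0 ≤ c j)
    (hs : ∀ l : ℝ, 0 ≤ l → Summable fun j => c j * Real.exp (l * ω ‖y j‖)) :
    ContDiff ℝ (⊤ : ℕ∞) (fun x => ∑' j, (c j : ℂ) * modGaussian (y j) x) ∧
      ∀ l : ℝ, 0 ≤ l → ∀ α : Fin N → ℕ, ∃ C : ℝ, ∀ x,
        Real.exp (l * ω ‖x‖) *
          ‖mderiv α (fun x => ∑' j, (c j : ℂ) * modGaussian (y j) x) x‖ ≤ C := by
  refine contDiff_tsum_and_decay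
    (fun j => contDiff_const.mul (contDiff_modGaussian (y j))) fun k l hl => ?_
  obtain ⟨B, hB, hBb⟩ := hω.exists_exp_mul_pow_mul_gaussian_le l hl k
  obtain ⟨D, p, hD, hp, hDp⟩ := hω.exists_pow_le_exp k
  refine ⟨fun j => (c j * Real.exp (p * ω ‖y j‖)) * (D * (k.factorial * B)),
    (hs _ hp).mul_right _, fun j x => ?_⟩
  rw [norm_iteratedFDeriv_const_mul _ (hc j) (contDiff_modGaussian (y j))]
  have hcj := hc j
  calc _ ≤ Real.exp (l * ω ‖x‖) * (c j * (k.factorial * (D * Real.exp (p * ω ‖y j‖)) *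
        ((1 + ‖x‖) ^ k * Real.exp (-(‖x‖ ^ 2 / 2))))) := by
        gcongr
        refine (norm_iteratedFDeriv_modGaussian_le (y j) x k).trans ?_
        gcongr
        exact hDp _ (norm_nonneg _)
    _ = (c j * Real.exp (p * ω ‖y j‖)) * (D * (k.factorial * (Real.exp (l * ω ‖x‖) *
        ((1 + ‖x‖) ^ k * Real.exp (-(‖x‖ ^ 2 / 2)))))) := by ring
    _ ≤ _ := by
        beta_reduce
        gcongr
        exact hBb _ (norm_nonneg _)

theorem modGaussian_zero_sub_mul_cexp (y x ξ : EuclideanSpace ℝ (Fin N)) :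
    modGaussian 0 (x - y) * Complex.exp (-(Complex.I * ((inner ℝ x ξ : ℝ) : ℂ))) =
      Complex.exp (-(Complex.I * ((inner ℝ y ξ : ℝ) : ℂ))) * modGaussian ξ (x - y) := by
  rw [modGaussian, modGaussian, ← Complex.exp_add, ← Complex.exp_add, gaussianPhase,
    gaussianPhase, inner_zero_left, inner_sub_right, real_inner_comm ξ x, real_inner_comm ξ y]
  congr 1
  push_cast
  ring

/-- Summability of `c` justifies integrating term by term, since all translates have the same `L¹`
norm. The Gaussian is its own transform up to a constant, and translation by `y_j` turns into
modulation. -/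
theorem fourierHat_gaussianSeries [Countable ι] {c : ι → ℝ} (hc : ∀ j, 0 ≤ c j)
    (hs : Summable c) (y : ι → EuclideanSpace ℝ (Fin N)) :
    fourierHat (gaussianSeries c y) =
      ((2 * Real.pi : ℂ) ^ ((N : ℂ) / 2)) •
        fun ξ => ∑' j, (c j : ℂ) * modGaussian (y j) ξ := by
  funext ξ
  have hint : ∀ j, MeasureTheory.Integrable fun x => (c j : ℂ) *
      (Complex.exp (-(Complex.I * ((inner ℝ (y j) ξ : ℝ) : ℂ))) * modGaussian ξ (x - y j)) :=
    fun j => (((integrable_modGaussian ξ).comp_sub_right (y j)).const_mul _).const_mul _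
  have hnorm : ∀ j, ∫ x, ‖(c j : ℂ) *
      (Complex.exp (-(Complex.I * ((inner ℝ (y j) ξ : ℝ) : ℂ))) * modGaussian ξ (x - y j))‖ =
      c j * ∫ x, ‖modGaussian ξ x‖ := by
    intro j
    rw [← MeasureTheory.integral_sub_right_eq_self (fun x => ‖modGaussian ξ x‖) (y j),
      ← MeasureTheory.integral_const_mul]
    refine MeasureTheory.integral_congr_ae (Filter.Eventually.of_forall fun x => ?_)
    simp only [norm_mul, Complex.norm_real, Real.norm_of_nonneg (hc j), Complex.norm_exp,
      Complex.neg_re, Complex.re_mul_ofReal, Complex.I_re]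
    simp
  have hsum := MeasureTheory.hasSum_integral_of_summable_integral_norm hint
    (by simp_rw [hnorm]; exact hs.mul_right _)
  calc fourierHat (gaussianSeries c y) ξ = ∫ x, ∑' j, (c j : ℂ) *
      (Complex.exp (-(Complex.I * ((inner ℝ (y j) ξ : ℝ) : ℂ))) * modGaussian ξ (x - y j)) := by
        refine MeasureTheory.integral_congr_ae (Filter.Eventually.of_forall fun x => ?_)
        simp only [gaussianSeries, ← tsum_mul_right, mul_assoc, modGaussian_zero_sub_mul_cexp]
    _ = _ := by
      rw [← hsum.tsum_eq, Pi.smul_apply, smul_eq_mul, ← tsum_mul_left]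
      refine tsum_congr fun j => ?_
      rw [MeasureTheory.integral_const_mul, MeasureTheory.integral_const_mul,
        MeasureTheory.integral_sub_right_eq_self (modGaussian ξ) (y j), integral_modGaussian,
        finrank_euclideanSpace_fin]
      have : modGaussian (y j) ξ =
          Complex.exp (-(Complex.I * ((inner ℝ (y j) ξ : ℝ) : ℂ))) * modGaussian 0 ξ := by
        rw [modGaussian, modGaussian, ← Complex.exp_add, gaussianPhase, gaussianPhase,
          inner_zero_left]
        congr 1
        push_cast
        ring
      rw [this]
      ring

theorem IsNonQuasianalyticWeight.integrable_of_decay (hω : IsNonQuasianalyticWeight ω)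
    {f : EuclideanSpace ℝ (Fin N) → ℂ} (hf : Continuous f)
    (h : ∀ l : ℝ, 0 ≤ l → ∃ C : ℝ, ∀ x, Real.exp (l * ω ‖x‖) * ‖f x‖ ≤ C) :
    MeasureTheory.Integrable f := by
  obtain ⟨D, p, hD, hp, hDp⟩ := hω.exists_pow_le_exp (N + 1)
  obtain ⟨C, hC⟩ := h p hp
  have hint : MeasureTheory.Integrable fun x : EuclideanSpace ℝ (Fin N) =>
      (1 + ‖x‖) ^ (-((N + 1 : ℕ) : ℝ)) :=
    integrable_one_add_norm (by rw [finrank_euclideanSpace_fin]; exact_mod_cast N.lt_succ_self)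
  refine (hint.const_mul (D * C)).mono' hf.aestronglyMeasurable
    (Filter.Eventually.of_forall fun x => ?_)
  have hx : 0 < 1 + ‖x‖ := by positivity
  rw [Real.rpow_neg hx.le, Real.rpow_natCast, ← div_eq_mul_inv, le_div_iff₀ (by positivity)]
  calc ‖f x‖ * (1 + ‖x‖) ^ (N + 1) ≤ ‖f x‖ * (D * Real.exp (p * ω ‖x‖)) := by
        gcongr
        exact hDp _ (norm_nonneg x)
    _ = D * (Real.exp (p * ω ‖x‖) * ‖f x‖) := by ring
    _ ≤ D * C := by
        gcongr
        exact hC x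

theorem gaussianSeries_mem_SSpace [Countable ι] (hω : IsNonQuasianalyticWeight ω) {c : ι → ℝ}
    {y : ι → EuclideanSpace ℝ (Fin N)} (hc : ∀ j, 0 ≤ c j)
    (hs : ∀ l : ℝ, 0 ≤ l → Summable fun j => c j * Real.exp (l * ω ‖y j‖)) :
    gaussianSeries c y ∈ SSpace N ω := by
  obtain ⟨h1, h2⟩ := gaussianSeries_contDiff_and_decay hω hc hs
  obtain ⟨h3, h4⟩ := modGaussianSeries_contDiff_and_decay hω hc hs
  have hsc : Summable c := by simpa using hs 0 le_rfl
  have hF := fourierHat_gaussianSeries hc hsc y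
  refine ⟨hω.integrable_of_decay h1.continuous fun l hl => ?_, h1, ?_, fun l hl α =>
    ⟨h2 l hl.le α, ?_⟩⟩
  · simpa [mderiv_zero_index] using h2 l hl 0
  · rw [hF]
    exact h3.const_smul ((2 * Real.pi : ℂ) ^ ((N : ℂ) / 2))
  · obtain ⟨C, hC⟩ := h4 l hl.le α
    refine ⟨‖(2 * Real.pi : ℂ) ^ ((N : ℂ) / 2)‖ * C, fun ξ => ?_⟩
    rw [hF, (mderiv_linear α _ h3 h3).2, Pi.smul_apply, norm_smul, mul_left_comm]
    gcongr
    exact hC ξ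

/-- The Gaussians sit at the integer lattice points, weighted by the supremum of `h` over a ball
that covers the adjacent cell. Passing to this supremum preserves rapid decay by (α), and no
regularity of `h` is needed. -/
theorem exists_mem_SSpace_le_norm (hω : IsNonQuasianalyticWeight ω)
    {h : EuclideanSpace ℝ (Fin N) → ℝ} (h0 : ∀ x, 0 ≤ h x)
    (hd : ∀ l : ℝ, 0 ≤ l → ∃ C : ℝ, ∀ x, Real.exp (l * ω ‖x‖) * h x ≤ C) :
    ∃ g ∈ SSpace N ω, ∀ x, h x ≤ ‖g x‖ := by
  let b := (EuclideanSpace.basisFun (Fin N) ℝ).toBasis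
  let L : Submodule ℤ (EuclideanSpace ℝ (Fin N)) := Submodule.span ℤ (Set.range b)
  set R : ℝ := ∑ i, ‖b i‖ with hR
  have hR0 : 0 ≤ R := Finset.sum_nonneg fun i _ => norm_nonneg _
  let H : L → ℝ := fun n => sSup (h '' Metric.closedBall (n : EuclideanSpace ℝ (Fin N)) R)
  have hH0 : ∀ n, 0 ≤ H n := fun n => Real.sSup_nonneg (by rintro _ ⟨x, _, rfl⟩; exact h0 x)
  obtain ⟨K, hK, hadd⟩ := hω.exists_add_le
  have hHd : ∀ l : ℝ, 0 ≤ l → ∃ D : ℝ, 0 ≤ D ∧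
      ∀ n : L, ∀ x ∈ Metric.closedBall (n : EuclideanSpace ℝ (Fin N)) R,
        h x ≤ D * Real.exp (-(l * ω ‖(n : EuclideanSpace ℝ (Fin N))‖)) := by
    intro l hl
    obtain ⟨C, hC⟩ := hd (l * K) (mul_nonneg hl (by linarith))
    have hC0 : 0 ≤ C := (mul_nonneg (Real.exp_pos _).le (h0 0)).trans (hC 0)
    refine ⟨Real.exp (l * K * (1 + ω R)) * C, by positivity, fun n x hx => ?_⟩
    have hnx : ‖(n : EuclideanSpace ℝ (Fin N))‖ ≤ ‖x‖ + R := by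
      have h1 := norm_sub_norm_le (n : EuclideanSpace ℝ (Fin N)) x
      rw [Metric.mem_closedBall, dist_comm, dist_eq_norm] at hx
      linarith
    have h1 := (hω.monotoneOn (norm_nonneg _) (Set.mem_Ici.2 (by positivity)) hnx).trans
      (hadd _ _ (norm_nonneg x) hR0)
    have h2 : l * ω ‖(n : EuclideanSpace ℝ (Fin N))‖ ≤ l * K * (1 + ω R) + l * K * ω ‖x‖ := by
      have := mul_le_mul_of_nonneg_left h1 hl
      linarith
    rw [Real.exp_neg, ← div_eq_mul_inv, le_div_iff₀ (Real.exp_pos _)]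
    calc h x * Real.exp (l * ω ‖(n : EuclideanSpace ℝ (Fin N))‖)
        ≤ h x * Real.exp (l * K * (1 + ω R) + l * K * ω ‖x‖) := by
          gcongr
          exact h0 x
      _ = Real.exp (l * K * (1 + ω R)) * (Real.exp (l * K * ω ‖x‖) * h x) := by
          rw [Real.exp_add]; ring
      _ ≤ _ := by
          gcongr
          exact hC x
  have hbdd : ∀ n : L, BddAbove (h '' Metric.closedBall (n : EuclideanSpace ℝ (Fin N)) R) := by
    intro n
    obtain ⟨D, -, hD⟩ := hHd 0 le_rfl
    refine ⟨D, ?_⟩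
    rintro _ ⟨x, hx, rfl⟩
    simpa using hD n x hx
  -- The factor `exp(R²/2)` offsets the loss of the Gaussian at distance `R` from its centre.
  let c : L → ℝ := fun n => Real.exp (R ^ 2 / 2) * H n
  have hc : ∀ n, 0 ≤ c n := fun n => mul_nonneg (Real.exp_pos _).le (hH0 n)
  have hs : ∀ l : ℝ, 0 ≤ l →
      Summable fun n : L => c n * Real.exp (l * ω ‖(n : EuclideanSpace ℝ (Fin N))‖) := by
    intro l hl
    -- The spare decay `exp(-p ω)` is traded for a power of `‖n‖⁻¹` summable over the lattice.
    obtain ⟨B, p, hB, hp, hBp⟩ := hω.exists_pow_le_exp (Module.finrank ℤ L + 1)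
    obtain ⟨D, hD0, hD⟩ := hHd (l + p) (by linarith)
    have hsum := (ZLattice.summable_norm_pow_inv L (Module.finrank ℤ L + 1)
      (Nat.lt_succ_self _)).mul_left (Real.exp (R ^ 2 / 2) * D * B)
    refine Summable.of_norm_bounded_eventually hsum ?_
    -- The origin is excluded because the majorant vanishes there: `0⁻¹ = 0`.
    refine (Set.finite_singleton (0 : L)).subset fun n hn => ?_
    by_contra hn0
    refine hn ?_
    set t := ‖(n : EuclideanSpace ℝ (Fin N))‖ with ht
    have ht0 : 0 < t := norm_pos_iff.2 fun h => hn0 (Subtype.ext h)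
    have hHn : H n ≤ D * Real.exp (-((l + p) * ω t)) := by
      refine Real.sSup_le ?_ (by positivity)
      rintro _ ⟨x, hx, rfl⟩
      exact hD n x hx
    have h1 : Real.exp (-(p * ω t)) ≤ B * t⁻¹ ^ (Module.finrank ℤ L + 1) := by
      rw [Real.exp_neg, inv_pow, ← div_eq_mul_inv, le_div_iff₀ (by positivity),
        inv_mul_le_iff₀ (Real.exp_pos _), mul_comm _ B]
      refine le_trans ?_ (hBp t ht0.le)
      gcongr
      linarith
    have hnorm : ‖c n * Real.exp (l * ω t)‖ = c n * Real.exp (l * ω t) :=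
      Real.norm_of_nonneg (mul_nonneg (hc n) (Real.exp_pos _).le)
    rw [Set.mem_ofPred_eq, hnorm]
    calc c n * Real.exp (l * ω t)
        ≤ Real.exp (R ^ 2 / 2) * (D * Real.exp (-((l + p) * ω t))) * Real.exp (l * ω t) := by
          simp only [c]
          gcongr
      _ = Real.exp (R ^ 2 / 2) * D * Real.exp (-(p * ω t)) := by
          rw [mul_assoc, mul_assoc, mul_assoc, ← Real.exp_add]
          ring_nf
      _ ≤ Real.exp (R ^ 2 / 2) * D * (B * t⁻¹ ^ (Module.finrank ℤ L + 1)) := by gcongr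
      _ = _ := by rw [← mul_assoc]; rfl
  refine ⟨gaussianSeries c (fun n : L => (n : EuclideanSpace ℝ (Fin N))),
    gaussianSeries_mem_SSpace hω hc hs, fun x => ?_⟩
  let n : L := ZSpan.floor b x
  have hxn : ‖x - n‖ ≤ R := ZSpan.norm_fract_le b x
  have hle := le_norm_gaussianSeries (fun n : L => (n : EuclideanSpace ℝ (Fin N))) hc
    (by simpa using hs 0 le_rfl) n x
  refine le_trans ?_ hle
  have h1 : h x ≤ H n := le_csSup (hbdd n) ⟨x, by rwa [Metric.mem_closedBall, dist_eq_norm], rfl⟩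
  have h2 : 1 ≤ Real.exp (R ^ 2 / 2) * Real.exp (-(‖x - n‖ ^ 2 / 2)) := by
    rw [← Real.exp_add, Real.one_le_exp_iff]
    have := pow_le_pow_left₀ (norm_nonneg _) hxn 2
    linarith
  calc h x ≤ H n * 1 := by linarith
    _ ≤ H n * (Real.exp (R ^ 2 / 2) * Real.exp (-(‖x - n‖ ^ 2 / 2))) := by
        gcongr
        exact hH0 n
    _ = _ := by simp only [c]; ring

theorem exists_mem_SSpace_ne_zero_le_norm (hω : IsNonQuasianalyticWeight ω)
    {h : EuclideanSpace ℝ (Fin N) → ℝ} (h0 : ∀ x, 0 ≤ h x)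
    (hd : ∀ l : ℝ, 0 ≤ l → ∃ C : ℝ, ∀ x, Real.exp (l * ω ‖x‖) * h x ≤ C) :
    ∃ g ∈ SSpace N ω, (∀ x, g x ≠ 0) ∧ ∀ x, h x ≤ ‖g x‖ := by
  obtain ⟨g, hg, hle⟩ := exists_mem_SSpace_le_norm hω
    -- The added Gaussian is strictly positive, which keeps `g` away from zero at every point.
    (h := fun x => h x + Real.exp (-(‖x‖ ^ 2 / 2))) (fun x => add_nonneg (h0 x) (Real.exp_pos _).le)
    fun l hl => by
      obtain ⟨C, hC⟩ := hd l hl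
      obtain ⟨B, -, hB⟩ := hω.exists_exp_mul_pow_mul_gaussian_le l hl 0
      refine ⟨C + B, fun x => ?_⟩
      have := hB ‖x‖ (norm_nonneg x)
      rw [pow_zero, one_mul] at this
      rw [mul_add]
      exact add_le_add (hC x) this
  refine ⟨g, hg, fun x hx => ?_, fun x => ?_⟩
  · have h1 := hle x
    rw [hx, norm_zero] at h1
    linarith [h0 x, Real.exp_pos (-(‖x‖ ^ 2 / 2))]
  · linarith [hle x, Real.exp_pos (-(‖x‖ ^ 2 / 2))]

end Series

/-! ### The quantities `q_{m,g}` -/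

section QNorm

variable {N : ℕ} {ω : ℝ → ℝ}

theorem youngConj_ne_bot (ω : ℝ → ℝ) (s : ℝ) : youngConj ω s ≠ ⊥ := by
  refine ne_bot_of_le_ne_bot (EReal.coe_ne_bot (s * 0 - ω (Real.exp 0))) ?_
  exact le_iSup (fun t : Set.Ici (0 : ℝ) =>
    ((s * (t : ℝ) - ω (Real.exp (t : ℝ)) : ℝ) : EReal)) ⟨0, Set.mem_Ici.2 le_rfl⟩

theorem youngWeight_cases (ω : ℝ → ℝ) {m : ℕ} (hm : 1 ≤ m) (α : Fin N → ℕ) :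
    youngWeight ω m α = ⊤ ∨
      ∃ c : ℝ, youngConj ω ((multiLength α : ℝ) / m) = c ∧
        youngWeight ω m α = ((m * c : ℝ) : EReal) := by
  have hm' : (0 : ℝ) < m := by exact_mod_cast hm
  unfold youngWeight
  induction h : youngConj ω ((multiLength α : ℝ) / m) with
  | bot => exact absurd h (youngConj_ne_bot ω _)
  | top => exact Or.inl (EReal.coe_mul_top_of_pos hm')
  | coe c => exact Or.inr ⟨c, rfl, rfl⟩

theorem youngWeight_ne_bot (ω : ℝ → ℝ) {m : ℕ} (hm : 1 ≤ m) (α : Fin N → ℕ) :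
    youngWeight ω m α ≠ ⊥ := by
  rcases youngWeight_cases ω hm α with h | ⟨c, -, h⟩ <;> rw [h]
  · exact top_ne_bot
  · exact EReal.coe_ne_bot _

/-- Formally `m φ*(s/m) = sup_t (s t - m ω(e^t))`, which decreases in `m` because `ω ≥ 0`. -/
theorem youngWeight_antitone (hω : IsNonQuasianalyticWeight ω) {m M : ℕ} (hm : 1 ≤ m)
    (hmM : m ≤ M) (α : Fin N → ℕ) : youngWeight ω M α ≤ youngWeight ω m α := by
  rcases youngWeight_cases ω hm α with h | ⟨c, hc, h⟩
  · rw [h]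
    exact le_top
  have hm' : (0 : ℝ) < m := by exact_mod_cast hm
  have hM' : (0 : ℝ) < M := by exact_mod_cast hm.trans hmM
  have hmM' : (m : ℝ) ≤ M := by exact_mod_cast hmM
  have hle : youngConj ω ((multiLength α : ℝ) / M) ≤ ((m * c / M : ℝ) : EReal) := by
    refine iSup_le fun t => EReal.coe_le_coe_iff.2 ?_
    have h1 : ((multiLength α : ℝ) / m * (t : ℝ) - ω (Real.exp (t : ℝ)) : ℝ) ≤ c := by
      rw [← EReal.coe_le_coe_iff, ← hc]
      exact le_iSup (fun t : Set.Ici (0 : ℝ) =>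
        (((multiLength α : ℝ) / m * (t : ℝ) - ω (Real.exp (t : ℝ)) : ℝ) : EReal)) t
    have h2 := mul_le_mul_of_nonneg_left h1 hm'.le
    have h3 := mul_le_mul_of_nonneg_right hmM' (hω.nonneg _ (Real.exp_pos (t : ℝ)).le)
    rw [mul_sub, ← mul_assoc, mul_div_cancel₀ _ hm'.ne'] at h2
    rw [le_div_iff₀ hM', sub_mul, mul_right_comm, div_mul_cancel₀ _ hM'.ne']
    linarith
  rw [h]
  calc youngWeight ω M α ≤ ((M : ℝ) : EReal) * ((m * c / M : ℝ) : EReal) :=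
        mul_le_mul_of_nonneg_left hle (EReal.coe_nonneg.2 hM'.le)
    _ = ((m * c : ℝ) : EReal) := by
        rw [← EReal.coe_mul, mul_div_cancel₀ _ hM'.ne']

/-- Only an inequality holds: when the weight is `⊤` the product is `∞ * 0 = 0`. -/
theorem exp_youngWeight_mul_exp_neg_le (ω : ℝ → ℝ) (m : ℕ) (α : Fin N → ℕ) :
    EReal.exp (youngWeight ω m α) * EReal.exp (-youngWeight ω m α) ≤ 1 := by
  rw [EReal.exp_neg]
  exact ENNReal.mul_inv_le_one _

theorem qNorm_add_le (m : ℕ) (g : EuclideanSpace ℝ (Fin N) → ℂ)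
    {f h : EuclideanSpace ℝ (Fin N) → ℂ} (hf : ContDiff ℝ (⊤ : ℕ∞) f)
    (hh : ContDiff ℝ (⊤ : ℕ∞) h) : qNorm ω m g (f + h) ≤ qNorm ω m g f + qNorm ω m g h := by
  refine iSup₂_le fun α x => ?_
  rw [(mderiv_linear α 0 hf hh).1]
  calc _ ≤ ‖g x‖ₑ * (‖mderiv α f x‖ₑ + ‖mderiv α h x‖ₑ) * EReal.exp (-youngWeight ω m α) := by
        gcongr
        exact enorm_add_le _ _
    _ = ‖g x‖ₑ * ‖mderiv α f x‖ₑ * EReal.exp (-youngWeight ω m α) +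
        ‖g x‖ₑ * ‖mderiv α h x‖ₑ * EReal.exp (-youngWeight ω m α) := by ring
    _ ≤ _ := add_le_add
        (le_iSup₂ (f := fun α x => ‖g x‖ₑ * ‖mderiv α f x‖ₑ * EReal.exp (-youngWeight ω m α)) α x)
        (le_iSup₂ (f := fun α x => ‖g x‖ₑ * ‖mderiv α h x‖ₑ * EReal.exp (-youngWeight ω m α)) α x)

theorem qNorm_smul (m : ℕ) (g : EuclideanSpace ℝ (Fin N) → ℂ) (c : ℂ)
    {f : EuclideanSpace ℝ (Fin N) → ℂ} (hf : ContDiff ℝ (⊤ : ℕ∞) f) :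
    qNorm ω m g (c • f) = ‖c‖ₑ * qNorm ω m g f := by
  unfold qNorm
  simp_rw [ENNReal.mul_iSup, (mderiv_linear _ c hf hf).2, Pi.smul_apply, enorm_smul]
  refine iSup_congr fun α => iSup_congr fun x => ?_
  ring

theorem qNorm_mono (hω : IsNonQuasianalyticWeight ω) {m M : ℕ} (hm : 1 ≤ m) (hmM : m ≤ M)
    {g h : EuclideanSpace ℝ (Fin N) → ℂ} (hgh : ∀ x, ‖g x‖ ≤ ‖h x‖)
    (f : EuclideanSpace ℝ (Fin N) → ℂ) : qNorm ω m g f ≤ qNorm ω M h f := by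
  refine iSup₂_mono fun α x => ?_
  gcongr
  · exact enorm_le_iff_norm_le.2 (hgh x)
  · exact EReal.neg_le_neg_iff.2 (youngWeight_antitone hω hm hmM α)

theorem eq_zero_of_qNorm_eq_zero (hω : IsNonQuasianalyticWeight ω) {m : ℕ}
    {g f : EuclideanSpace ℝ (Fin N) → ℂ} (hg : ∀ x, g x ≠ 0) (h : qNorm ω m g f = 0) :
    f = 0 := by
  funext x
  -- The term `α = 0` suffices: `φ*(0) ≤ 0` because `ω ≥ 0`, so its exponential factor is at least
  -- 1.
  have hx : ‖g x‖ₑ * ‖mderiv 0 f x‖ₑ * EReal.exp (-youngWeight ω m (0 : Fin N → ℕ)) = 0 :=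
    le_antisymm (h ▸ le_iSup₂ (f := fun (α : Fin N → ℕ) x =>
      ‖g x‖ₑ * ‖mderiv α f x‖ₑ * EReal.exp (-youngWeight ω m α)) 0 x) zero_le
  have hW : youngWeight ω m (0 : Fin N → ℕ) ≤ 0 := by
    have hle : youngConj ω ((multiLength (0 : Fin N → ℕ) : ℝ) / m) ≤ 0 := by
      refine iSup_le fun t => ?_
      have := hω.nonneg _ (Real.exp_pos (t : ℝ)).le
      simpa [multiLength] using this
    exact (mul_le_mul_of_nonneg_left hle (EReal.coe_nonneg.2 m.cast_nonneg)).trans_eq (mul_zero _)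
  have hexp : EReal.exp (-youngWeight ω m (0 : Fin N → ℕ)) ≠ 0 := by
    refine fun h0 => ?_
    have h1 : EReal.exp 0 ≤ EReal.exp (-youngWeight ω m (0 : Fin N → ℕ)) :=
      EReal.exp_monotone (EReal.le_neg_of_le_neg (by simpa using hW))
    rw [h0, EReal.exp_zero] at h1
    exact one_ne_zero (le_antisymm h1 zero_le)
  rw [mderiv_zero_index] at hx
  simpa [hg x, hexp] using hx

theorem exists_exp_mul_norm_le_of_mem_SSpace (hω : IsNonQuasianalyticWeight ω)
    {g : EuclideanSpace ℝ (Fin N) → ℂ} (hg : g ∈ SSpace N ω) (l : ℝ) :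
    ∃ C : ℝ, ∀ x, Real.exp (l * ω ‖x‖) * ‖g x‖ ≤ C := by
  -- `SSpace` gives bounds only for positive exponents, hence `max l 1`.
  obtain ⟨C, hC⟩ := (hg.2.2.2 (max l 1) (by positivity) 0).1
  refine ⟨C, fun x => le_trans ?_ (hC x)⟩
  rw [mderiv_zero_index]
  gcongr
  · exact hω.nonneg _ (norm_nonneg x)
  · exact le_max_left _ _

theorem qNorm_lt_top_of_mem_OMSet (hω : IsNonQuasianalyticWeight ω)
    {f g : EuclideanSpace ℝ (Fin N) → ℂ} (hf : f ∈ OMSet N ω) (hg : g ∈ SSpace N ω) {m : ℕ}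
    (hm : 1 ≤ m) : qNorm ω m g f < ⊤ := by
  obtain ⟨C, hC, n, -, h⟩ := hf.2 m hm
  obtain ⟨D, hD⟩ := exists_exp_mul_norm_le_of_mem_SSpace hω hg n
  refine lt_of_le_of_lt (iSup₂_le fun α x => ?_) (ENNReal.ofReal_lt_top (r := C * D))
  have hadd : EReal.exp ((((n : ℝ) * ω ‖x‖ : ℝ) : EReal) + youngWeight ω m α) =
      ENNReal.ofReal (Real.exp (n * ω ‖x‖)) * EReal.exp (youngWeight ω m α) := by
    rw [EReal.exp_add, EReal.exp_coe]
  calc _ ≤ ‖g x‖ₑ * (ENNReal.ofReal C * (ENNReal.ofReal (Real.exp (n * ω ‖x‖)) *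
        EReal.exp (youngWeight ω m α))) * EReal.exp (-youngWeight ω m α) := by
        gcongr
        exact hadd ▸ h α x
    _ = ENNReal.ofReal C * (ENNReal.ofReal (Real.exp (n * ω ‖x‖)) * ‖g x‖ₑ) *
        (EReal.exp (youngWeight ω m α) * EReal.exp (-youngWeight ω m α)) := by ring
    _ ≤ ENNReal.ofReal C * (ENNReal.ofReal (Real.exp (n * ω ‖x‖)) * ‖g x‖ₑ) * 1 := by
        gcongr
        exact exp_youngWeight_mul_exp_neg_le ω m α
    _ ≤ ENNReal.ofReal (C * D) := by
        rw [mul_one, ENNReal.ofReal_mul hC.le, ← ofReal_norm,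
          ← ENNReal.ofReal_mul (Real.exp_pos _).le]
        gcongr
        exact hD x

theorem mem_OMSet_of_qNorm_lt_top (hω : IsNonQuasianalyticWeight ω)
    {f : EuclideanSpace ℝ (Fin N) → ℂ} (hf : ContDiff ℝ (⊤ : ℕ∞) f)
    (h : ∀ g ∈ SSpace N ω, ∀ m : ℕ, 1 ≤ m → qNorm ω m g f < ⊤) : f ∈ OMSet N ω := by
  refine ⟨hf, fun m hm => ?_⟩
  by_contra! hcon
  -- The constant is chosen so that `exp(j + 1)` cancels the factor in `c j` that forces
  -- summability, while `j + 1` remains and tends to infinity. The points `x j` need be neither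
  -- distinct nor unbounded.
  have hj : ∀ j : ℕ, ∃ (α : Fin N → ℕ) (x : EuclideanSpace ℝ (Fin N)),
      ENNReal.ofReal ((j + 1) * Real.exp (j + 1)) *
        EReal.exp (((((j + 1 : ℕ) : ℝ) * ω ‖x‖ : ℝ) : EReal) + youngWeight ω m α) <
      ‖mderiv α f x‖ₑ := fun j => hcon _ (by positivity) (j + 1) (by omega)
  choose α x hx using hj
  let c : ℕ → ℝ := fun j => Real.exp (-((j + 1) * (ω ‖x j‖ + 1)))
  have hc : ∀ j, 0 ≤ c j := fun j => (Real.exp_pos _).le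
  have hs : ∀ l : ℝ, 0 ≤ l → Summable fun j => c j * Real.exp (l * ω ‖x j‖) := by
    intro l hl
    refine Summable.of_norm_bounded_eventually_nat Real.summable_exp_neg_nat ?_
    filter_upwards [Filter.eventually_ge_atTop ⌈l⌉₊] with j hj
    have hlj : l ≤ j := (Nat.le_ceil l).trans (by exact_mod_cast hj)
    have hω0 := hω.nonneg _ (norm_nonneg (x j))
    rw [Real.norm_of_nonneg (mul_nonneg (hc j) (Real.exp_pos _).le), ← Real.exp_add,
      Real.exp_le_exp]
    -- For `j ≥ l` the exponent is `-(j + 1) + (l - j - 1) ω(x_j) ≤ -j`.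
    nlinarith [mul_le_mul_of_nonneg_right hlj hω0]
  have hsc : Summable c := by simpa using hs 0 le_rfl
  refine (h _ (gaussianSeries_mem_SSpace hω hc hs) m hm).ne
    (ENNReal.eq_top_of_forall_nnreal_le fun r => ?_)
  obtain ⟨j, hj⟩ := exists_nat_ge r
  set W := youngWeight ω m (α j) with hW
  -- An infinite weight would make the left side of the strict inequality `hx j` infinite.
  -- Finiteness turns the cancellation of exponentials into an equality.
  have hWtop : W ≠ ⊤ := by
    intro hWt
    have hxj := hx j
    rw [← hW, hWt, EReal.coe_add_top, EReal.exp_top,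
      ENNReal.mul_top (ENNReal.ofReal_pos.2 (by positivity)).ne'] at hxj
    exact not_top_lt hxj
  have hexp : EReal.exp W * EReal.exp (-W) = 1 := by
    rw [EReal.exp_neg]
    refine ENNReal.mul_inv_cancel (fun h0 => ?_) (fun ht => hWtop (EReal.exp_eq_top_iff.1 ht))
    exact youngWeight_ne_bot ω hm (α j) (EReal.exp_eq_zero_iff.1 h0)
  have hg : c j ≤ ‖gaussianSeries c x (x j)‖ := by
    simpa using le_norm_gaussianSeries x hc hsc j (x j)
  have hreal : c j * ((j + 1) * Real.exp (j + 1)) * Real.exp (((j + 1 : ℕ) : ℝ) * ω ‖x j‖) =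
      j + 1 := by
    have : c j * Real.exp (j + 1) * Real.exp (((j + 1 : ℕ) : ℝ) * ω ‖x j‖) = 1 := by
      rw [← Real.exp_add, ← Real.exp_add, Real.exp_eq_one_iff]
      push_cast
      ring
    linear_combination (j + 1 : ℝ) * this
  calc (r : ℝ≥0∞) ≤ ENNReal.ofReal (j + 1) := by
        rw [← ENNReal.ofReal_coe_nnreal]
        refine ENNReal.ofReal_le_ofReal ?_
        have : (r : ℝ) ≤ j := by exact_mod_cast hj
        linarith
    _ = ENNReal.ofReal (c j) * (ENNReal.ofReal ((j + 1) * Real.exp (j + 1)) *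
        (ENNReal.ofReal (Real.exp (((j + 1 : ℕ) : ℝ) * ω ‖x j‖)) * EReal.exp W)) *
          EReal.exp (-W) := by
        have h1 := congrArg ENNReal.ofReal hreal
        rw [ENNReal.ofReal_mul (mul_nonneg (hc j) (by positivity)),
          ENNReal.ofReal_mul (hc j)] at h1
        rw [← h1]
        simp only [mul_assoc, hexp, mul_one]
    _ ≤ ‖gaussianSeries c x (x j)‖ₑ * ‖mderiv (α j) f (x j)‖ₑ * EReal.exp (-W) := by
        gcongr
        · rw [← ofReal_norm]
          exact ENNReal.ofReal_le_ofReal hg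
        · have := (hx j).le
          rwa [EReal.exp_add, EReal.exp_coe] at this
    _ ≤ _ := le_iSup₂ (f := fun α y => ‖gaussianSeries c x y‖ₑ * ‖mderiv α f y‖ₑ *
        EReal.exp (-youngWeight ω m α)) (α j) (x j)

end QNorm

/-! ### The topology generated by the balls of a family of seminorms -/

/-- A ball of a finite supremum of seminorms is the finite intersection of the balls with the same
centre and radius. Conversely, by the triangle inequality, each generating ball contains a smaller
ball of the same seminorm about each of its points. -/
theorem withSeminorms_generateFrom_balls {𝕜 E ι : Type*} [NormedField 𝕜] [AddCommGroup E]
    [Module 𝕜 E] (p : SeminormFamily 𝕜 E ι) :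
    @WithSeminorms 𝕜 E ι _ _ _ p
      (TopologicalSpace.generateFrom {U | ∃ i f₀ ε, 0 < ε ∧ U = (p i).ball f₀ ε}) := by
  set t := TopologicalSpace.generateFrom {U | ∃ i f₀ ε, 0 < ε ∧ U = (p i).ball f₀ ε} with ht
  refine @WithSeminorms.mk 𝕜 E ι _ _ _ p t (le_antisymm ?_ ?_)
  · intro U hU
    have hp : @WithSeminorms 𝕜 E ι _ _ _ p p.moduleFilterBasis.topology :=
      @WithSeminorms.mk 𝕜 E ι _ _ _ p p.moduleFilterBasis.topology rfl
    refine (@isOpen_iff_forall_mem_open E t U).2 fun x hx => ?_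
    obtain ⟨s, r, hr, hsub⟩ :=
      (@WithSeminorms.isOpen_iff_mem_balls 𝕜 E ι _ _ _ p.moduleFilterBasis.topology p hp U).1 hU x hx
    refine ⟨_, hsub, ?_, Seminorm.mem_ball_self _ hr⟩
    rw [Seminorm.ball_finset_sup_eq_iInter _ _ _ hr]
    exact @isOpen_biInter_finset E ι t s _ fun i _ =>
      TopologicalSpace.isOpen_generateFrom_of_mem ⟨i, x, r, hr, rfl⟩
  · refine le_generateFrom ?_
    rintro _ ⟨i, f₀, ε, hε, rfl⟩
    let := p.moduleFilterBasis.topology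
    have hp : WithSeminorms p := ⟨rfl⟩
    refine (hp.isOpen_iff_mem_balls _).2 fun x hx => ?_
    rw [Seminorm.mem_ball] at hx
    refine ⟨{i}, ε - p i (x - f₀), sub_pos.2 hx, fun z hz => ?_⟩
    rw [Finset.sup_singleton, Seminorm.mem_ball] at hz
    rw [Seminorm.mem_ball]
    have := map_add_le_add (p i) (z - x) (x - f₀)
    rw [sub_add_sub_cancel] at this
    linarith

/-! ### The seminorms `q_{m,g}` and their directedness -/

section Seminorms

variable {N : ℕ} {ω : ℝ → ℝ}

/-- The seminorm `q_{m,g}` on `O_{M,ω}`. -/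
noncomputable def qSeminorm (hω : IsNonQuasianalyticWeight ω) :
    SeminormFamily ℂ (OMSpace N hω) (ℕ+ × SSpace N ω) := fun i =>
  Seminorm.of
    (fun f => (qNorm ω (i.1 : ℕ) i.2 (f : EuclideanSpace ℝ (Fin N) → ℂ)).toReal)
    (fun f h => by
      have hf := (qNorm_lt_top_of_mem_OMSet hω f.2 i.2.2 i.1.pos).ne
      have hh := (qNorm_lt_top_of_mem_OMSet hω h.2 i.2.2 i.1.pos).ne
      refine le_of_le_of_eq ?_ (ENNReal.toReal_add hf hh)
      exact ENNReal.toReal_mono (ENNReal.add_ne_top.2 ⟨hf, hh⟩) (qNorm_add_le _ _ f.2.1 h.2.1))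
    (fun c f => by
      rw [Submodule.coe_smul, qNorm_smul _ _ _ f.2.1, ENNReal.toReal_mul, toReal_enorm])

theorem ofReal_qSeminorm (hω : IsNonQuasianalyticWeight ω) (i : ℕ+ × SSpace N ω)
    (f : OMSpace N hω) : ENNReal.ofReal (qSeminorm hω i f) =
      qNorm ω (i.1 : ℕ) i.2 (f : EuclideanSpace ℝ (Fin N) → ℂ) :=
  ENNReal.ofReal_toReal (qNorm_lt_top_of_mem_OMSet hω f.2 i.2.2 i.1.pos).ne

theorem qSeminorm_ball (hω : IsNonQuasianalyticWeight ω) (i : ℕ+ × SSpace N ω)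
    (f₀ : OMSpace N hω) {ε : ℝ} (hε : 0 < ε) : (qSeminorm hω i).ball f₀ ε =
      {f | qNorm ω (i.1 : ℕ) i.2 ((f - f₀ : OMSpace N hω) : EuclideanSpace ℝ (Fin N) → ℂ) <
        ENNReal.ofReal ε} := by
  ext f
  rw [Seminorm.mem_ball, Set.mem_ofPred_eq, ← ofReal_qSeminorm hω i (f - f₀),
    ENNReal.ofReal_lt_ofReal_iff hε]

theorem withSeminorms_qSeminorm (hω : IsNonQuasianalyticWeight ω) :
    @WithSeminorms ℂ (OMSpace N hω) (ℕ+ × SSpace N ω) _ _ _ (qSeminorm hω)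
      (tauTopology N hω) := by
  have h : tauTopology N hω = TopologicalSpace.generateFrom
      {U | ∃ i f₀ ε, 0 < ε ∧ U = (qSeminorm (N := N) hω i).ball f₀ ε} := by
    refine congrArg TopologicalSpace.generateFrom (Set.ext fun U => ⟨?_, ?_⟩)
    · rintro ⟨m, hm, g, hg, f₀, ε, hε, rfl⟩
      exact ⟨(⟨m, hm⟩, ⟨g, hg⟩), f₀, ε, hε, (qSeminorm_ball hω (⟨m, hm⟩, ⟨g, hg⟩) f₀ hε).symm⟩
    · rintro ⟨i, f₀, ε, hε, rfl⟩
      exact ⟨i.1, i.1.pos, i.2, i.2.2, f₀, ε, hε, qSeminorm_ball hω i f₀ hε⟩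
  rw [h]
  exact withSeminorms_generateFrom_balls _

/-- A zero-free `g` dominates the sum of the finitely many `|g_i|`, and `m` exceeds all the `m_i`;
monotonicity of `q` in both parameters does the rest. -/
theorem exists_qNorm_ge_of_finset (hω : IsNonQuasianalyticWeight ω)
    (s : Finset (ℕ+ × SSpace N ω)) :
    ∃ m : ℕ, 1 ≤ m ∧ ∃ g ∈ SSpace N ω, (∀ x, g x ≠ 0) ∧
      ∀ i ∈ s, ∀ f, qNorm ω (i.1 : ℕ) i.2 f ≤ qNorm ω m g f := by
  obtain ⟨g, hg, hg0, hle⟩ := exists_mem_SSpace_ne_zero_le_norm hω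
    (h := fun x => ∑ i ∈ s, ‖(i.2 : EuclideanSpace ℝ (Fin N) → ℂ) x‖)
    (fun x => Finset.sum_nonneg fun i _ => norm_nonneg _) fun l _ => by
      choose C hC using fun i : ℕ+ × SSpace N ω =>
        exists_exp_mul_norm_le_of_mem_SSpace hω i.2.2 l
      refine ⟨∑ i ∈ s, C i, fun x => ?_⟩
      rw [Finset.mul_sum]
      exact Finset.sum_le_sum fun i _ => hC i x
  -- The `+ 1` keeps `m ≥ 1` even when `s` is empty.
  refine ⟨(s.sup fun i => (i.1 : ℕ)) + 1, by omega, g, hg, hg0, fun i hi f => ?_⟩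
  refine qNorm_mono hω i.1.pos
    ((Finset.le_sup (f := fun i : ℕ+ × SSpace N ω => (i.1 : ℕ)) hi).trans (Nat.le_succ _))
    (fun x => le_trans ?_ (hle x)) f
  exact Finset.single_le_sum
    (f := fun i : ℕ+ × SSpace N ω => ‖(i.2 : EuclideanSpace ℝ (Fin N) → ℂ) x‖)
    (fun _ _ => norm_nonneg _) hi

end Seminorms

theorem theorem5p1 (N : ℕ) (ω : ℝ → ℝ) (hω : IsNonQuasianalyticWeight ω) :
    -- the characterization of `O_{M,ω}`
    (∀ f : EuclideanSpace ℝ (Fin N) → ℂ, ContDiff ℝ (⊤ : ℕ∞) f →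
      (f ∈ OMSpace N hω ↔
        ∀ g ∈ SSpace N ω, ∀ m : ℕ, 1 ≤ m → qNorm ω m g f < ⊤)) ∧
    -- the `q_{m,g}` are seminorms on `O_{M,ω}`, and `τ` is the locally convex Hausdorff topology
    -- that they define
    (∃ p : SeminormFamily ℂ (OMSpace N hω) (ℕ+ × SSpace N ω),
      (∀ (i : ℕ+ × SSpace N ω) (f : OMSpace N hω),
        ENNReal.ofReal (p i f) = qNorm ω (i.1 : ℕ) i.2 (f : EuclideanSpace ℝ (Fin N) → ℂ)) ∧
      @WithSeminorms ℂ (OMSpace N hω) (ℕ+ × SSpace N ω) _ _ _ p (tauTopology N hω)) ∧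
    @T2Space (OMSpace N hω) (tauTopology N hω) ∧
    -- `q_{m,g}` is a norm if `g` has no zeros, and already the balls of these norms form a
    -- fundamental system of neighbourhoods of zero for `τ`
    (∀ m : ℕ, 1 ≤ m → ∀ g ∈ SSpace N ω, (∀ x, g x ≠ 0) → ∀ f : OMSpace N hω,
      qNorm ω m g (f : EuclideanSpace ℝ (Fin N) → ℂ) = 0 → f = 0) ∧
    (@nhds (OMSpace N hω) (tauTopology N hω) 0).HasBasis
      (fun i : ℕ × (EuclideanSpace ℝ (Fin N) → ℂ) × ℝ =>
        1 ≤ i.1 ∧ (i.2.1 ∈ SSpace N ω ∧ ∀ x, i.2.1 x ≠ 0) ∧ 0 < i.2.2)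
      (fun i => {f : OMSpace N hω |
        qNorm ω i.1 i.2.1 (f : EuclideanSpace ℝ (Fin N) → ℂ) < ENNReal.ofReal i.2.2}) := by
  let := tauTopology N hω
  have hp : WithSeminorms (qSeminorm (N := N) hω) := withSeminorms_qSeminorm hω
  have hnorm : ∀ m : ℕ, 1 ≤ m → ∀ g ∈ SSpace N ω, (∀ x, g x ≠ 0) → ∀ f : OMSpace N hω,
      qNorm ω m g (f : EuclideanSpace ℝ (Fin N) → ℂ) = 0 → f = 0 :=
    fun _ _ _ _ hg0 _ hf => Subtype.ext (eq_zero_of_qNorm_eq_zero hω hg0 hf)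
  refine ⟨fun f hf => ⟨fun h g hg m hm => qNorm_lt_top_of_mem_OMSet hω h hg hm,
    mem_OMSet_of_qNorm_lt_top hω hf⟩, ⟨qSeminorm hω, ofReal_qSeminorm hω, hp⟩, ?_, hnorm, ?_⟩
  · have := hp.topologicalAddGroup
    have : T1Space (OMSpace N hω) := hp.T1_of_separating fun f hf => by
      -- The empty family already yields a zero-free `g`, so a single norm separates points.
      obtain ⟨m, hm, g, hg, hg0, -⟩ := exists_qNorm_ge_of_finset (N := N) hω ∅
      refine ⟨(⟨m, hm⟩, ⟨g, hg⟩), fun h0 => hf (hnorm m hm g hg hg0 f ?_)⟩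
      have h1 := ofReal_qSeminorm hω (⟨m, hm⟩, ⟨g, hg⟩) f
      rw [h0, ENNReal.ofReal_zero] at h1
      exact h1.symm
    infer_instance
  · refine ⟨fun U => ?_⟩
    rw [hp.mem_nhds_iff]
    constructor
    · rintro ⟨s, r, hr, hsub⟩
      obtain ⟨m, hm, g, hg, hg0, hle⟩ := exists_qNorm_ge_of_finset hω s
      refine ⟨(m, g, r), ⟨hm, ⟨hg, hg0⟩, hr⟩, fun f hf => hsub ?_⟩
      rw [Seminorm.mem_ball, sub_zero]
      refine Seminorm.finset_sup_apply_lt hr fun i hi => ?_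
      rw [← ENNReal.ofReal_lt_ofReal_iff hr, ofReal_qSeminorm]
      exact (hle i hi f).trans_lt hf
    · rintro ⟨⟨m, g, r⟩, ⟨hm, ⟨hg, -⟩, hr⟩, hsub⟩
      refine ⟨{(⟨m, hm⟩, ⟨g, hg⟩)}, r, hr, ?_⟩
      rw [Finset.sup_singleton, qSeminorm_ball hω _ _ hr]
      simpa only [sub_zero, PNat.mk_coe] using hsub
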